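/- **Setting.** Let $H$ be a real Hilbert space, $m\ge 1$, let $A_1,\dots,A_m:H\rightrightarrows H$ be maximally monotone set-valued operators, and let $B,C:H\to H$ be cocoercive with parameters $\eta>0$ and $\mu>0$ respectively, i.e. $\langle x-y,Bx-By\rangle\ge\eta\|Bx-By\|^2$ and $\langle x-y,Cx-Cy\rangle\ge\mu\|Cx-Cy\|^2$ for all $x,y\in H$. Write $\operatorname{zer}C=\{x: Cx=0\}$; let $N_{\operatorname{zer}C}(x)=\{p:\langle p,z-x\rangle\le 0\ \forall z\in\operatorname{zer}C\}$ for $x\in\operatorname{zer}C$ and $N_{\operatorname{zer}C}(x)=\emptyset$ otherwise; let $\sigma_{\operatorname{zer}C}(p)=\sup_{z\in\operatorname{zer}C}\langle p,z\rangle$, and let $\varphi_C(x,u)=\sup_{y\in H}\{\langle x,Cy\rangle+\langle y,u\rangle-\langle y,Cy\rangle\}$ be the Fitzpatrick function of $C$. Put $$\mathcal Z=\Big\{x\in H:\ 0\in\sum_{i=1}^m A_i(x)+Bx+N_{\operatorname{zer}C}(x)\Big\}$$ and assume $\mathcal Z\neq\emptyset$. Let $(\alpha_k)_{k\ge1}$,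 $(\beta_k)_{k\ge1}$ be sequences of positive reals, let $x_1\in H$, and let $(x_k)_{k\ge 1}$ be generated by the generalized forward-backward method with penalty term (GFBP): for $k\ge1$, $$\psi_{0,k}=x_k-\alpha_kBx_k-\alpha_k\beta_kCx_k,\qquad \psi_{i,k}=(I+\alpha_kA_i)^{-1}\psi_{i-1,k}\ (i=1,\dots,m),\qquad x_{k+1}=\psi_{m,k}.$$ Let $z_k=\big(\sum_{n=1}^k\alpha_n\big)^{-1}\sum_{n=1}^k\alpha_nx_n$. **Theorem.** Assume - (H1) $\operatorname{zer}C\cap\bigcap_{i=1}^m\operatorname{int}(\operatorname{dom}A_i)\ne\emptyset$, where $\operatorname{dom}A_i=\{x:A_i(x)\neq\emptyset\}$; - (H2) for every $p$ in the range of $N_{\operatorname{zer}C}$, $\displaystyle\sum_{k=1}^\infty\alpha_k\beta_k\Big[\sup_{u\in\operatorname{zer}C}\varphi_C\big(u,\tfrac p{\beta_k}\big)-\sigma_{\operatorname{zer}C}\big(\tfrac p{\beta_k}\big)\Big]<+\infty$; - (H3) $0<\liminf_{k\to\infty}\alpha_k\beta_k\le\limsup_{k\to\infty}\alpha_k\beta_k<\mu$,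 where $\mu$ is the cocoercivity parameter of $C$; - (H4) $\sum_k\alpha_k^2<\infty$ and $\sum_k\alpha_k=\infty$. Then: (i) For every $u\in\mathcal Z$, $\lim_{k\to\infty}\|x_k-u\|$ exists, and the series $\sum_{k}\sum_{i=1}^m\|\psi_{i,k}-\psi_{i-1,k}\|^2$, $\sum_k\alpha_k\beta_k\|Cx_k\|^2$ and $\sum_k\alpha_k\beta_k\langle x_k-u,Cx_k\rangle$ converge. (ii) For every $u\in\mathcal Z$, $\displaystyle\lim_{k\to\infty}\sum_{i=1}^m\|\psi_{i,k}-\psi_{i-1,k}\|^2=\lim_{k\to\infty}\langle x_k-u,Cx_k\rangle=\lim_{k\to\infty}\|Cx_k\|=0$. (iii) $(z_k)$ converges weakly to an element of $\mathcal Z$. -/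

import Mathlib

open Filter Topology
open scoped Pointwise RealInnerProductSpace

namespace PenaltySplitting

noncomputable section

/-! Set-valued operators on a real Hilbert space `H` are functions `T : H → Set H`.
Their sums `S + T`, finite sums `∑ i, A i` and multiples `a • T` are the pointwise
(Minkowski) ones: `(S + T) x = {s + t | s ∈ S x, t ∈ T x}`, `(a • T) x = {a • t | t ∈ T x}`. -/

variable {H : Type*} [NormedAddCommGroup H] [InnerProductSpace ℝ H]

/-- The graph of a set-valued operator. -/
def opGraph (T : H → Set H) : Set (H × H) := {q | q.2 ∈ T q.1}

/-- The domain of a set-valued operator. -/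
def opDomain (T : H → Set H) : Set H := {x | (T x).Nonempty}

/-- The range of a set-valued operator. -/
def opRange (T : H → Set H) : Set H := {u | ∃ x, u ∈ T x}

/-- The set of zeros of a set-valued operator. -/
def zeros (T : H → Set H) : Set H := {x | (0 : H) ∈ T x}

/-- A single-valued operator, seen as a set-valued one. -/
def ofFun (F : H → H) : H → Set H := fun x => {F x}

/-- Monotone set-valued operators. -/
def IsMonotoneOp (T : H → Set H) : Prop :=
  ∀ x u y v : H, u ∈ T x → v ∈ T y → 0 ≤ ⟪x - y, u - v⟫

/-- Maximally monotone operators: monotone, and the graph is not properly contained in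
the graph of another monotone operator. -/
def IsMaximallyMonotone (T : H → Set H) : Prop :=
  IsMonotoneOp T ∧ ∀ S : H → Set H, IsMonotoneOp S → opGraph T ⊆ opGraph S → opGraph S = opGraph T

/-- Cocoercivity of a single-valued operator with parameter `μ`. -/
def IsCocoercive (μ : ℝ) (F : H → H) : Prop :=
  0 < μ ∧ ∀ x y : H, μ * ‖F x - F y‖ ^ 2 ≤ ⟪x - y, F x - F y⟫

/-- The resolvent `(I + T)⁻¹` as a set-valued operator: `x ∈ opResolvent T y` iff
`y ∈ (I + T) x`. It is single-valued when `T` is maximally monotone. -/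
def opResolvent (T : H → Set H) : H → Set H := fun y => {x | y ∈ (ofFun (fun z : H => z) + T) x}

/-- The normal cone operator of a set `X`; its value is empty outside `X`. -/
def normalCone (X : Set H) : H → Set H :=
  fun x => {p | x ∈ X ∧ ∀ z ∈ X, ⟪p, z - x⟫ ≤ 0}

/-- The support function of a set. -/
def supportFun (X : Set H) (p : H) : EReal := ⨆ z ∈ X, ((⟪p, z⟫ : ℝ) : EReal)

/-- The Fitzpatrick function of a set-valued operator. -/
def fitzpatrick (T : H → Set H) (x u : H) : EReal :=
  ⨆ q ∈ opGraph T, ((⟪x, q.2⟫ + ⟪q.1, u⟫ - ⟪q.1, q.2⟫ : ℝ) : EReal)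

/-- The difference `sup_{u ∈ zer C} φ_C(u, p) - σ_{zer C}(p)`. -/
def fitzpatrickGap (C : H → H) (p : H) : EReal :=
  (⨆ u ∈ zeros (ofFun C), fitzpatrick (ofFun C) u p) - supportFun (zeros (ofFun C)) p

/-- The gap is nonnegative at the points where the summability condition below uses it, so
that the series there is a series of nonnegative extended reals and `EReal.toENNReal`
does not cut anything off. -/
theorem fitzpatrickGap_nonneg (C : H → H) {p : H} (hp : p ∈ opRange (normalCone (zeros (ofFun C))))
    {b : ℝ} (hb : 0 < b) : 0 ≤ fitzpatrickGap C (b⁻¹ • p) := by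
  obtain ⟨x, hx, hxp⟩ := hp
  have hσ : supportFun (zeros (ofFun C)) (b⁻¹ • p) ≤ ((⟪b⁻¹ • p, x⟫ : ℝ) : EReal) := by
    refine iSup₂_le fun z hz => EReal.coe_le_coe_iff.2 ?_
    have h1 := hxp z hz
    rw [inner_sub_right] at h1
    rw [real_inner_smul_left, real_inner_smul_left]
    exact mul_le_mul_of_nonneg_left (by linarith) (inv_pos.2 hb).le
  have hx0 : (0 : H) ∈ ofFun C x := hx
  have hφ : ((⟪b⁻¹ • p, x⟫ : ℝ) : EReal) ≤
      ⨆ u ∈ zeros (ofFun C), fitzpatrick (ofFun C) u (b⁻¹ • p) := by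
    refine le_trans ?_ (le_iSup₂ (f := fun u _ => fitzpatrick (ofFun C) u (b⁻¹ • p)) x hx)
    refine le_trans ?_ (le_iSup₂ (f := fun (q : H × H) (_ : q ∈ opGraph (ofFun C)) =>
      ((⟪x, q.2⟫ + ⟪q.1, b⁻¹ • p⟫ - ⟪q.1, q.2⟫ : ℝ) : EReal)) (x, (0 : H)) hx0)
    refine EReal.coe_le_coe_iff.2 (le_of_eq ?_)
    simp only [inner_zero_right, zero_add, sub_zero]
    exact real_inner_comm _ _
  have hbot : ((⟪b⁻¹ • p, x⟫ : ℝ) : EReal) ≤ supportFun (zeros (ofFun C)) (b⁻¹ • p) :=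
    le_iSup₂ (f := fun z (_ : z ∈ zeros (ofFun C)) => ((⟪b⁻¹ • p, z⟫ : ℝ) : EReal)) x hx
  exact (EReal.sub_nonneg (Or.inr (hσ.trans_lt (EReal.coe_lt_top _)).ne)
    (Or.inr ((EReal.bot_lt_coe _).trans_le hbot).ne')).2 (hσ.trans hφ)

/-- The operator `∑ i, A i + B + N_{zer C}` of the monotone inclusion problem. -/
def inclusionOp {m : ℕ} (A : Fin m → H → Set H) (B C : H → H) : H → Set H :=
  (∑ i, A i) + ofFun B + normalCone (zeros (ofFun C))

/-- `x` and `ψ` are generated by the generalized forward-backward method with penalty term,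
with step sizes `α` and penalty parameters `β`; `ψ k i` is the `i`-th inner iterate
(`i = 0, …, m`) of the `k`-th outer step. Outer steps are counted from `0`. -/
structure IsGFBP {m : ℕ} (A : Fin m → H → Set H) (B C : H → H) (α β : ℕ → ℝ)
    (x : ℕ → H) (ψ : ℕ → Fin (m + 1) → H) : Prop where
  forward_step : ∀ k, ψ k 0 = x k - α k • B (x k) - (α k * β k) • C (x k)
  backward_step : ∀ k (i : Fin m), ψ k i.succ ∈ opResolvent (α k • A i) (ψ k i.castSucc)
  next_iterate : ∀ k, x (k + 1) = ψ k (Fin.last m)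

/-- The weighted averages `z k = (∑_{n ≤ k} α n)⁻¹ • ∑_{n ≤ k} α n • x n`. -/
def ergodicAverage (α : ℕ → ℝ) (x : ℕ → H) (k : ℕ) : H :=
  (∑ n ∈ Finset.range (k + 1), α n)⁻¹ • ∑ n ∈ Finset.range (k + 1), α n • x n

/-- The summability condition in terms of the Fitzpatrick function: for every
`p ∈ ran N_{zer C}`, the series of the terms
`α_k β_k [sup_{u ∈ zer C} φ_C(u, p / β_k) - σ_{zer C}(p / β_k)]` is finite. -/
def FitzpatrickSummable (C : H → H) (α β : ℕ → ℝ) : Prop :=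
  ∀ p ∈ opRange (normalCone (zeros (ofFun C))),
    ∑' k, (((α k * β k : ℝ) : EReal) * fitzpatrickGap C ((β k)⁻¹ • p)).toENNReal < ⊤

end

end PenaltySplitting

open PenaltySplitting

/-! Everything rests on one inequality. Fix `w = ∑ vᵢ + B u + p` in the inclusion operator at `u`.
Monotonicity of the `Aᵢ` handles the backward steps (`backward_estimate`), cocoercivity of `B` and
`C` the forward step (`forward_estimate`), and the Fitzpatrick condition pays for the normal vector
`p`. Up to a summable error, `‖x (k+1) - u‖²` is then at most `‖x k - u‖² + 2 α k ⟪u - x k, w⟫`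
minus nonnegative residuals (`IsGFBP.exists_step_le`).

For `w = 0` the sequence is quasi-Fejér: distances to solutions converge and the residuals are
summable. For general `w`, summing and dividing by `∑ α → ∞` gives `⟪u - z, w⟫ ≥ 0` for every weak
cluster point `z` of the averages. The inclusion operator is maximally monotone, so `z` is a
solution, and an Opial argument makes the cluster point unique.

Maximality of the sum is proved from scratch: Minty's theorem from a proximal point of the
Fitzpatrick function, sums with cocoercive maps by contraction, Rockafellar's theorem by Yosida
approximation. -/

namespace PenaltySplitting

variable {H : Type*} [NormedAddCommGroup H] [InnerProductSpace ℝ H]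

/-! ### Maximally monotone operators -/

/-- Maximality in terms of monotonically related points. -/
theorem IsMaximallyMonotone.mem_of_forall {T : H → Set H} (hT : IsMaximallyMonotone T) {x u : H}
    (h : ∀ y v, v ∈ T y → 0 ≤ ⟪x - y, u - v⟫) : u ∈ T x := by
  -- Adjoin the single point `(x, u)` to the graph.
  have key := hT.2 (fun z => T z ∪ {w | z = x ∧ w = u}) ?_ ?_
  · have : (x, u) ∈ opGraph (fun z => T z ∪ {w | z = x ∧ w = u}) := Or.inr ⟨rfl, rfl⟩
    rw [key] at this
    exact this
  · rintro a s b t (hs | ⟨rfl, rfl⟩) (ht | ⟨rfl, rfl⟩)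
    · exact hT.1 _ _ _ _ hs ht
    · have := h a s hs
      rwa [← neg_sub a, ← neg_sub s, inner_neg_neg] at this
    · exact h b t ht
    · simp
  · exact fun q hq => Or.inl hq

theorem isMaximallyMonotone_of_forall {T : H → Set H} (hT : IsMonotoneOp T)
    (h : ∀ x u, (∀ y v, v ∈ T y → 0 ≤ ⟪x - y, u - v⟫) → u ∈ T x) : IsMaximallyMonotone T := by
  refine ⟨hT, fun S hS hTS => Set.Subset.antisymm (fun q hq => ?_) hTS⟩
  exact h q.1 q.2 fun y v hv => hS _ _ _ _ hq (hTS (a := (y, v)) hv)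

/-- Easy half of Minty's theorem. If `(x, u)` is monotonically related to the graph, pick `(z, v)`
in the graph with `z + c v = x + c u`; then `x - z = -c (u - v)` forces `-c ‖u - v‖² ≥ 0`, so the
two points coincide. -/
theorem isMaximallyMonotone_of_surjective {T : H → Set H} (hT : IsMonotoneOp T) {c : ℝ}
    (hc : 0 < c) (h : ∀ y, ∃ x, ∃ u ∈ T x, x + c • u = y) : IsMaximallyMonotone T := by
  refine isMaximallyMonotone_of_forall hT fun x u hxu => ?_
  obtain ⟨z, v, hv, hz⟩ := h (x + c • u)
  have h1 := hxu z v hv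
  have h2 : x - z = -(c • (u - v)) := by
    rw [smul_sub, neg_sub, sub_eq_sub_iff_add_eq_add, ← hz, add_comm]
  rw [h2, inner_neg_left, real_inner_smul_left, real_inner_self_eq_norm_sq] at h1
  have h3 : u - v = 0 := by
    rw [← norm_eq_zero, ← sq_eq_zero_iff]
    nlinarith [sq_nonneg ‖u - v‖]
  have h4 : x = z := by rw [← sub_eq_zero, h2, h3, smul_zero, neg_zero]
  rwa [h4, sub_eq_zero.1 h3]

/-- Existence of the proximal point of `0`, for a convex function given by its epigraph, with
the variational inequality that characterizes it. -/
theorem exists_prox_zero {E : Type*} [NormedAddCommGroup E] [InnerProductSpace ℝ E]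
    [CompleteSpace E] {K : Set (E × ℝ)} (hne : K.Nonempty) (hcl : IsClosed K)
    (hcv : Convex ℝ K) {b : ℝ} (hb : ∀ q s, (q, s) ∈ K → b ≤ s + ‖q‖ ^ 2 / 2) :
    ∃ q s, (q, s) ∈ K ∧ ∀ q' s', (q', s') ∈ K → s + ⟪q, q - q'⟫ ≤ s' := by
  set V : Set ℝ := (fun r : E × ℝ => r.2 + ‖r.1‖ ^ 2 / 2) '' K with hV
  have hVb : BddBelow V := ⟨b, by rintro _ ⟨r, hr, rfl⟩; exact hb _ _ hr⟩
  have hVne : V.Nonempty := hne.image _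
  set I := sInf V
  have hI : ∀ q s, (q, s) ∈ K → I ≤ s + ‖q‖ ^ 2 / 2 := fun q s h =>
    csInf_le hVb ⟨(q, s), h, rfl⟩
  have hex : ∀ n : ℕ, ∃ r ∈ K, r.2 + ‖r.1‖ ^ 2 / 2 < I + 1 / ((n : ℝ) + 1) := by
    intro n
    obtain ⟨_, ⟨r, hr, rfl⟩, hlt⟩ := exists_lt_of_csInf_lt hVne
      (show sInf V < I + 1 / ((n : ℝ) + 1) from lt_add_of_pos_right _ (by positivity))
    exact ⟨r, hr, hlt⟩
  choose r hrK hr using hex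
  -- The objective at the midpoint is the average of the two values minus `‖·‖²/8` of the
  -- difference, yet at least the infimum `I`. So the minimizing sequence is Cauchy.
  have hdist : ∀ n k, ‖(r n).1 - (r k).1‖ ^ 2 ≤ 4 * (1 / ((n : ℝ) + 1) + 1 / ((k : ℝ) + 1)) := by
    intro n k
    have hmid := hcv (hrK n) (hrK k) (by norm_num : (0 : ℝ) ≤ 1 / 2)
      (by norm_num : (0 : ℝ) ≤ 1 / 2) (by norm_num)
    have h1 := hI _ _ hmid
    have h2 := parallelogram_law_with_norm ℝ (r n).1 (r k).1
    simp only [Prod.smul_fst, Prod.smul_snd, smul_eq_mul, ← smul_add, norm_smul, mul_pow] at h1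
    norm_num at h1
    have h3 := hr n
    have h4 := hr k
    norm_num at h3 h4 ⊢
    nlinarith
  have hlim0 : Tendsto (fun n : ℕ => 1 / ((n : ℝ) + 1)) atTop (𝓝 0) :=
    tendsto_one_div_add_atTop_nhds_zero_nat
  have hcau : CauchySeq fun n => (r n).1 := by
    refine cauchySeq_of_le_tendsto_0 (fun N => √(4 * (1 / ((N : ℝ) + 1) + 1 / ((N : ℝ) + 1))))
      (fun n k N hn hk => ?_) ?_
    · rw [dist_eq_norm]
      refine Real.le_sqrt_of_sq_le ((hdist n k).trans ?_)
      gcongr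
    · have := ((hlim0.add hlim0).const_mul 4).sqrt
      simpa using this
  obtain ⟨q, hq⟩ := cauchySeq_tendsto_of_complete hcau
  have hval : Tendsto (fun n => (r n).2 + ‖(r n).1‖ ^ 2 / 2) atTop (𝓝 I) := by
    refine tendsto_of_tendsto_of_tendsto_of_le_of_le tendsto_const_nhds
      (by simpa using hlim0.const_add I) (fun n => hI _ _ (hrK n)) fun n => (hr n).le
  have hs : Tendsto (fun n => (r n).2) atTop (𝓝 (I - ‖q‖ ^ 2 / 2)) := by
    have := hval.sub ((hq.norm.pow 2).div_const 2)
    simpa using this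
  have hmem : (q, I - ‖q‖ ^ 2 / 2) ∈ K :=
    hcl.mem_of_tendsto (hq.prodMk_nhds hs) (Eventually.of_forall fun n => hrK n)
  refine ⟨q, I - ‖q‖ ^ 2 / 2, hmem, fun q' s' h' => ?_⟩
  -- First-order optimality: compare the minimizer with points of the segment towards `(q', s')`,
  -- divide by `t`, then let `t → 0`.
  have hline : ∀ t : ℝ, 0 < t → t ≤ 1 →
      0 ≤ (s' - (I - ‖q‖ ^ 2 / 2)) + ⟪q, q' - q⟫ + t * (‖q' - q‖ ^ 2 / 2) := by
    intro t ht ht1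
    have h1 := hI _ _ (hcv hmem h' (sub_nonneg.2 ht1) ht.le (by ring))
    have h2 : (1 - t) • q + t • q' = q + t • (q' - q) := by
      rw [smul_sub, sub_smul, one_smul]; abel
    simp only [Prod.smul_fst, Prod.smul_snd, smul_eq_mul] at h1
    rw [h2, norm_add_sq_real, real_inner_smul_right, norm_smul, mul_pow, Real.norm_eq_abs,
      sq_abs] at h1
    have h3 : 0 ≤ t * ((s' - (I - ‖q‖ ^ 2 / 2)) + ⟪q, q' - q⟫ + t * (‖q' - q‖ ^ 2 / 2)) := by
      nlinarith
    exact nonneg_of_mul_nonneg_right h3 ht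
  have h0 : 0 ≤ (s' - (I - ‖q‖ ^ 2 / 2)) + ⟪q, q' - q⟫ := by
    have ht : Tendsto (fun n : ℕ => (s' - (I - ‖q‖ ^ 2 / 2)) + ⟪q, q' - q⟫ +
        1 / ((n : ℝ) + 1) * (‖q' - q‖ ^ 2 / 2)) atTop
        (𝓝 ((s' - (I - ‖q‖ ^ 2 / 2)) + ⟪q, q' - q⟫ + 0 * (‖q' - q‖ ^ 2 / 2))) :=
      (hlim0.mul_const _).const_add _
    rw [zero_mul, add_zero] at ht
    refine ge_of_tendsto' ht fun n => hline _ (by positivity) ?_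
    rw [div_le_one (by positivity)]
    linarith [n.cast_nonneg (α := ℝ)]
  rw [← neg_sub q, inner_neg_right] at h0
  linarith

theorem IsMaximallyMonotone.exists_mem {T : H → Set H} (hT : IsMaximallyMonotone T) :
    ∃ x u, u ∈ T x := by
  by_contra! h
  exact h 0 0 (hT.mem_of_forall fun y v hv => absurd hv (h y v))

/-- Minty's theorem at `0`. -/
theorem IsMaximallyMonotone.exists_neg_mem [CompleteSpace H] {T : H → Set H}
    (hT : IsMaximallyMonotone T) : ∃ x, -x ∈ T x := by
  -- `K` is the epigraph of the Fitzpatrick function of `T`; the `L²` product makes the base a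
  -- Hilbert space. `hgraph` and `hge` say that this function is at most the duality pairing on the
  -- graph and at least the pairing everywhere.
  set K : Set (WithLp 2 (H × H) × ℝ) :=
    {r | ∀ y v, v ∈ T y → ⟪r.1.fst, v⟫ + ⟪y, r.1.snd⟫ - ⟪y, v⟫ ≤ r.2} with hK
  have hgraph : ∀ y v, v ∈ T y → (WithLp.toLp 2 (y, v), ⟪y, v⟫) ∈ K := by
    intro y v hv z w hw
    have := hT.1 _ _ _ _ hv hw
    simp only [inner_sub_left, inner_sub_right] at this
    change ⟪y, w⟫ + ⟪z, v⟫ - ⟪z, w⟫ ≤ ⟪y, v⟫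
    linarith
  have hge : ∀ (q : WithLp 2 (H × H)) (s : ℝ), (q, s) ∈ K → ⟪q.fst, q.snd⟫ ≤ s := by
    intro q s hq
    by_contra! hlt
    have hmem : q.snd ∈ T q.fst := hT.mem_of_forall fun y v hv => by
      have := hq y v hv
      simp only [inner_sub_left, inner_sub_right]
      simp only at this
      linarith
    have := hq _ _ hmem
    simp only at this
    linarith
  have hcl : IsClosed K := by
    simp only [hK, Set.ofPred_forall]
    refine isClosed_iInter fun y => isClosed_iInter fun v => isClosed_iInter fun _ => ?_
    refine isClosed_le ?_ continuous_snd
    have h1 : Continuous fun r : WithLp 2 (H × H) × ℝ => r.1.fst := by fun_prop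
    have h2 : Continuous fun r : WithLp 2 (H × H) × ℝ => r.1.snd := by fun_prop
    exact ((h1.inner continuous_const).add (continuous_const.inner h2)).sub continuous_const
  have hcv : Convex ℝ K := by
    intro r hr r' hr' a b ha hb hab y v hv
    have h1 := mul_le_mul_of_nonneg_left (hr y v hv) ha
    have h2 := mul_le_mul_of_nonneg_left (hr' y v hv) hb
    simp only [Prod.fst_add, Prod.snd_add, Prod.smul_fst, Prod.smul_snd, smul_eq_mul,
      WithLp.add_fst, WithLp.add_snd, WithLp.smul_fst, WithLp.smul_snd, inner_add_left,
      inner_add_right, real_inner_smul_left, real_inner_smul_right]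
    have h3 : ⟪y, v⟫ = a * ⟪y, v⟫ + b * ⟪y, v⟫ := by rw [← add_mul, hab, one_mul]
    linarith
  obtain ⟨y₀, v₀, hv₀⟩ := hT.exists_mem
  obtain ⟨q, s, hqs, hvar⟩ := exists_prox_zero (b := 0) ⟨_, hgraph y₀ v₀ hv₀⟩ hcl hcv (by
    intro q s hq
    have h1 := hge q s hq
    have h2 := norm_add_sq_real q.fst q.snd
    rw [WithLp.prod_norm_sq_eq_of_L2]
    nlinarith [sq_nonneg ‖q.fst + q.snd‖])
  -- The variational inequality at graph points makes `(-q.snd, -q.fst)` monotonically related to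
  -- the graph, hence a point of it. Testing at that very point then gives `q.fst + q.snd = 0`.
  have hrel : ∀ y v, v ∈ T y → ‖q.fst + q.snd‖ ^ 2 ≤ ⟪-q.snd - y, -q.fst - v⟫ := by
    intro y v hv
    have h1 := hvar _ _ (hgraph y v hv)
    have h2 := hge q s hqs
    have h3 := norm_add_sq_real q.fst q.snd
    simp only [WithLp.prod_inner_apply, inner_sub_right, real_inner_self_eq_norm_sq] at h1
    simp only [WithLp.ofLp_fst, WithLp.ofLp_snd] at h1
    simp only [inner_sub_left, inner_sub_right, inner_neg_left, inner_neg_right]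
    rw [real_inner_comm q.fst y, real_inner_comm q.fst q.snd]
    linarith
  have hmem : -q.fst ∈ T (-q.snd) :=
    hT.mem_of_forall fun y v hv => (sq_nonneg _).trans (hrel y v hv)
  have h0 := hrel _ _ hmem
  simp only [sub_self, inner_zero_left] at h0
  have h1 : q.fst + q.snd = 0 := by
    rw [← norm_eq_zero, ← sq_eq_zero_iff]
    exact le_antisymm h0 (sq_nonneg _)
  refine ⟨-q.snd, ?_⟩
  rw [neg_neg]
  rwa [neg_eq_of_add_eq_zero_right h1] at hmem

/-- Minty's theorem: `I + c T` is surjective. -/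
theorem IsMaximallyMonotone.exists_smul_sub_mem [CompleteSpace H] {T : H → Set H}
    (hT : IsMaximallyMonotone T) {c : ℝ} (hc : 0 < c) (y : H) :
    ∃ x, c⁻¹ • (y - x) ∈ T x := by
  -- The operator `c T - y`: Minty at `0` for it is the claim.
  have hS : IsMaximallyMonotone fun z => {u | c⁻¹ • (u + y) ∈ T z} := by
    refine isMaximallyMonotone_of_forall (fun x u z v hu hv => ?_) fun x u h => ?_
    · have := hT.1 _ _ _ _ hu hv
      rw [← smul_sub, real_inner_smul_right, add_sub_add_right_eq_sub] at this
      exact nonneg_of_mul_nonneg_right this (inv_pos.2 hc)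
    · refine hT.mem_of_forall fun z w hw => ?_
      have h1 := h z (c • w - y) (by
        simpa only [Set.mem_ofPred_eq, sub_add_cancel, smul_smul, inv_mul_cancel₀ hc.ne', one_smul]
          using hw)
      have h2 : c⁻¹ • (u + y) - w = c⁻¹ • (u - (c • w - y)) := by
        rw [sub_sub_eq_add_sub, smul_sub, smul_smul, inv_mul_cancel₀ hc.ne', one_smul]
      rw [h2, real_inner_smul_right]
      exact mul_nonneg (inv_pos.2 hc).le h1
  obtain ⟨x, hx⟩ := hS.exists_neg_mem
  refine ⟨x, ?_⟩
  rwa [sub_eq_neg_add]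

theorem IsCocoercive.isMonotoneOp {F : H → H} {η : ℝ} (hF : IsCocoercive η F) :
    IsMonotoneOp (ofFun F) := by
  rintro x _ y _ rfl rfl
  exact le_trans (mul_nonneg hF.1.le (sq_nonneg _)) (hF.2 x y)

theorem IsCocoercive.norm_sub_le {F : H → H} {η : ℝ} (hF : IsCocoercive η F) (x y : H) :
    η * ‖F x - F y‖ ≤ ‖x - y‖ := by
  rcases (norm_nonneg (F x - F y)).eq_or_lt with h | h
  · rw [← h, mul_zero]; exact norm_nonneg _
  · have := (hF.2 x y).trans (real_inner_le_norm _ _)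
    nlinarith

theorem IsMonotoneOp.add {S T : H → Set H} (hS : IsMonotoneOp S) (hT : IsMonotoneOp T) :
    IsMonotoneOp (S + T) := by
  rintro x _ y _ ⟨u, hu, v, hv, rfl⟩ ⟨u', hu', v', hv', rfl⟩
  have h1 := hS _ _ _ _ hu hu'
  have h2 := hT _ _ _ _ hv hv'
  change 0 ≤ ⟪x - y, u + v - (u' + v')⟫
  rw [add_sub_add_comm, inner_add_right]
  exact add_nonneg h1 h2

/-- The Yosida approximation of a maximally monotone operator. -/
theorem IsMaximallyMonotone.exists_yosida [CompleteSpace H] {T : H → Set H}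
    (hT : IsMaximallyMonotone T) {c : ℝ} (hc : 0 < c) :
    ∃ F : H → H, IsCocoercive c F ∧ ∀ y, F y ∈ T (y - c • F y) := by
  choose J hJ using hT.exists_smul_sub_mem hc
  have hF : ∀ y, c⁻¹ • (y - J y) ∈ T (y - c • c⁻¹ • (y - J y)) := fun y => by
    rw [smul_smul, mul_inv_cancel₀ hc.ne', one_smul, sub_sub_cancel]
    exact hJ y
  refine ⟨fun y => c⁻¹ • (y - J y), ⟨hc, fun x y => ?_⟩, hF⟩
  have h1 := hT.1 _ _ _ _ (hF x) (hF y)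
  rw [sub_sub_sub_comm, ← smul_sub, inner_sub_left, real_inner_smul_left,
    real_inner_self_eq_norm_sq] at h1
  linarith

/-- The sum of a maximally monotone operator and a cocoercive one is maximally monotone. -/
theorem IsMaximallyMonotone.add_ofFun [CompleteSpace H] {T : H → Set H}
    (hT : IsMaximallyMonotone T) {F : H → H} {η : ℝ} (hF : IsCocoercive η F) :
    IsMaximallyMonotone (T + ofFun F) := by
  have hc : 0 < η / 2 := half_pos hF.1
  refine isMaximallyMonotone_of_surjective (hT.1.add hF.isMonotoneOp) hc fun y => ?_
  choose J hJ using hT.exists_smul_sub_mem hc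
  have hJn : ∀ a b, ‖J a - J b‖ ≤ ‖a - b‖ := by
    intro a b
    have h1 := hT.1 _ _ _ _ (hJ a) (hJ b)
    rw [← smul_sub, real_inner_smul_right, sub_sub_sub_comm, inner_sub_right,
      real_inner_self_eq_norm_sq] at h1
    have h2 := nonneg_of_mul_nonneg_right h1 (inv_pos.2 hc)
    have h3 := real_inner_le_norm (J a - J b) (a - b)
    nlinarith [norm_nonneg (J a - J b), norm_nonneg (a - b)]
  -- `J` is nonexpansive and `F` is `1/η`-Lipschitz, so step `η / 2` gives factor `1/2`. A fixed
  -- point solves `y ∈ x + (η / 2)(T + F) x`.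
  have hcontr : ContractingWith (1 / 2) fun x => J (y - (η / 2) • F x) := by
    refine ⟨by rw [← NNReal.coe_lt_coe]; norm_num, LipschitzWith.of_dist_le_mul fun a b => ?_⟩
    rw [dist_eq_norm, dist_eq_norm]
    refine (hJn _ _).trans ?_
    rw [sub_sub_sub_cancel_left, ← smul_sub, norm_smul, Real.norm_of_nonneg hc.le,
      norm_sub_rev (F b)]
    have := hF.norm_sub_le a b
    push_cast
    linarith
  obtain ⟨x, hx⟩ : ∃ x, J (y - (η / 2) • F x) = x := ⟨_, hcontr.fixedPoint_isFixedPt⟩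
  have h := hJ (y - (η / 2) • F x)
  rw [hx] at h
  refine ⟨x, _, ⟨_, h, F x, rfl, rfl⟩, ?_⟩
  simp only [smul_add, smul_smul, mul_inv_cancel₀ hc.ne', one_smul]
  abel

/-! ### Weak limits -/

/-- Bounded families have weak limits along ultrafilters. -/
theorem exists_weak_limit [CompleteSpace H] {ι : Type*} (l : Ultrafilter ι) {u : ι → H} {M : ℝ}
    (hu : ∀ i, ‖u i‖ ≤ M) : ∃ w : H, ∀ h, Tendsto (fun i => ⟪u i, h⟫) l (𝓝 ⟪w, h⟫) := by
  have hbd : ∀ h i, |⟪u i, h⟫| ≤ M * ‖h‖ := fun h i =>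
    (abs_real_inner_le_norm _ _).trans (mul_le_mul_of_nonneg_right (hu i) (norm_nonneg _))
  have hex : ∀ h, ∃ t : ℝ, Tendsto (fun i => ⟪u i, h⟫) l (𝓝 t) := by
    intro h
    obtain ⟨t, -, ht⟩ := (isCompact_Icc (a := -(M * ‖h‖)) (b := M * ‖h‖)).ultrafilter_le_nhds
      (l.map fun i => ⟪u i, h⟫) (by
        rw [le_principal_iff]
        exact eventually_map.2 (Eventually.of_forall fun i => abs_le.1 (hbd h i)))
    exact ⟨t, ht⟩
  choose f hf using hex
  let φ : H →ₗ[ℝ] ℝ :=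
    { toFun := f
      map_add' := fun a b => tendsto_nhds_unique (hf (a + b)) <| by
        simpa only [inner_add_right] using (hf a).add (hf b)
      map_smul' := fun c a => tendsto_nhds_unique (hf (c • a)) <| by
        simpa only [real_inner_smul_right, smul_eq_mul, RingHom.id_apply]
          using (hf a).const_mul c }
  let Φ : StrongDual ℝ H := φ.mkContinuous M fun h => by
    rw [Real.norm_eq_abs]
    exact le_of_tendsto (hf h).abs (Eventually.of_forall (hbd h))
  refine ⟨(InnerProductSpace.toDual ℝ H).symm Φ, fun h => ?_⟩
  rw [InnerProductSpace.toDual_symm_apply]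
  exact hf h

theorem tendsto_inner_of_weak {ι : Type*} {l : Filter ι} {a u : ι → H} {a₀ u₀ : H} {M : ℝ}
    (ha : Tendsto a l (𝓝 a₀)) (hM : ∀ i, ‖u i‖ ≤ M)
    (hu : ∀ h, Tendsto (fun i => ⟪u i, h⟫) l (𝓝 ⟪u₀, h⟫)) :
    Tendsto (fun i => ⟪a i, u i⟫) l (𝓝 ⟪a₀, u₀⟫) := by
  have h1 : Tendsto (fun i => ⟪a i - a₀, u i⟫) l (𝓝 0) := by
    refine squeeze_zero_norm (a := fun i => ‖a i - a₀‖ * M) (fun i => ?_) ?_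
    · exact (norm_inner_le_norm _ _).trans (mul_le_mul_of_nonneg_left (hM i) (norm_nonneg _))
    · simpa using (tendsto_iff_norm_sub_tendsto_zero.1 ha).mul_const M
  have h2 := h1.add (hu a₀)
  simpa only [inner_sub_left, real_inner_comm a₀, sub_add_cancel, zero_add] using h2

/-- Graphs of maximally monotone operators are closed for the strong convergence of points
and the bounded weak convergence of values. -/
theorem IsMaximallyMonotone.mem_of_tendsto {T : H → Set H} (hT : IsMaximallyMonotone T)
    {ι : Type*} {l : Filter ι} [l.NeBot] {a u : ι → H} {a₀ u₀ : H} {M : ℝ}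
    (hmem : ∀ i, u i ∈ T (a i)) (ha : Tendsto a l (𝓝 a₀)) (hM : ∀ i, ‖u i‖ ≤ M)
    (hu : ∀ h, Tendsto (fun i => ⟪u i, h⟫) l (𝓝 ⟪u₀, h⟫)) : u₀ ∈ T a₀ := by
  refine hT.mem_of_forall fun y v hv => ?_
  have h1 : Tendsto (fun i => ⟪a i - y, u i - v⟫) l (𝓝 ⟪a₀ - y, u₀ - v⟫) := by
    simp only [inner_sub_right]
    exact (tendsto_inner_of_weak (ha.sub_const y) hM hu).sub
      ((ha.sub_const y).inner tendsto_const_nhds)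
  exact ge_of_tendsto' h1 fun i => hT.1 _ _ _ _ (hmem i) hv

/-! ### Sums of maximally monotone operators -/

/-- If `x₀` is interior to the domain of `T`, then values `u i ∈ T (a i)` at bounded points with
`⟪a i - x₀, u i⟫` bounded above are bounded. -/
theorem IsMonotoneOp.exists_bound_of_mem_interior [CompleteSpace H] {T : H → Set H}
    (hT : IsMonotoneOp T) {x₀ : H} (hx₀ : x₀ ∈ interior (opDomain T)) {ι : Type*} {a u : ι → H}
    (hmem : ∀ i, u i ∈ T (a i)) {R S : ℝ} (hR : ∀ i, ‖a i - x₀‖ ≤ R)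
    (hS : ∀ i, ⟪a i - x₀, u i⟫ ≤ S) : ∃ M, ∀ i, ‖u i‖ ≤ M := by
  -- Test monotonicity at a domain point `x₀ + t h`, `t > 0`. The bound depends on `h`;
  -- Banach–Steinhaus makes it uniform.
  have hone : ∀ h, ∃ c, ∀ i, ⟪u i, h⟫ ≤ c := by
    intro h
    have hc : Tendsto (fun t : ℝ => x₀ + t • h) (𝓝[>] 0) (𝓝 x₀) := by
      have : Continuous fun t : ℝ => x₀ + t • h := by fun_prop
      have h2 := this.tendsto 0
      simp only [zero_smul, add_zero] at h2
      exact h2.mono_left nhdsWithin_le_nhds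
    obtain ⟨t, ht, htpos⟩ :=
      ((hc.eventually (mem_interior_iff_mem_nhds.1 hx₀)).and self_mem_nhdsWithin).exists
    obtain ⟨w, hw⟩ := ht
    refine ⟨(S + (R + ‖t • h‖) * ‖w‖) / t, fun i => ?_⟩
    rw [le_div_iff₀ (by exact htpos)]
    have h1 := hT _ _ _ _ (hmem i) hw
    have h2 : -⟪a i - x₀ - t • h, w⟫ ≤ (R + ‖t • h‖) * ‖w‖ := by
      refine (neg_le_abs _).trans ((abs_real_inner_le_norm _ _).trans ?_)
      gcongr
      exact (norm_sub_le _ _).trans (add_le_add_left (hR i) _)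
    rw [← sub_sub, inner_sub_right, inner_sub_left _ (t • h) (u i), real_inner_smul_left,
      real_inner_comm (u i) h] at h1
    linarith [hS i]
  obtain ⟨M, hM⟩ := banach_steinhaus (g := fun i => innerSL ℝ (u i)) fun h => by
    obtain ⟨c, hc⟩ := hone h
    obtain ⟨c', hc'⟩ := hone (-h)
    refine ⟨max c c', fun i => ?_⟩
    rw [innerSL_apply_apply, Real.norm_eq_abs, abs_le]
    have := hc' i
    rw [inner_neg_right] at this
    exact ⟨by linarith [le_max_right c c'], (hc i).trans (le_max_left _ _)⟩
  exact ⟨M, fun i => by simpa using hM i⟩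

/-- Rockafellar's sum theorem in Hilbert spaces. -/
theorem IsMaximallyMonotone.add [CompleteSpace H] {A T : H → Set H}
    (hA : IsMaximallyMonotone A) (hT : IsMaximallyMonotone T) {x₀ : H} (hxA : x₀ ∈ opDomain A)
    (hxT : x₀ ∈ interior (opDomain T)) : IsMaximallyMonotone (A + T) := by
  refine isMaximallyMonotone_of_surjective (hA.1.add hT.1) one_pos fun y => ?_
  obtain ⟨v₀, hv₀⟩ := hxA
  obtain ⟨b₀, hb₀⟩ := interior_subset hxT
  set c : ℕ → ℝ := fun n => 1 / ((n : ℝ) + 1) with hc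
  have hcpos : ∀ n, 0 < c n := fun n => by positivity
  have hc1 : ∀ n, c n ≤ 1 := fun n => by
    rw [hc, div_le_one (by positivity)]
    linarith [n.cast_nonneg (α := ℝ)]
  have hc0 : Tendsto c atTop (𝓝 0) := tendsto_one_div_add_atTop_nhds_zero_nat
  -- Solve the inclusion with `T` replaced by its Yosida approximations of parameter `c n → 0`, then
  -- pass to the limit.
  choose F hF hFT using fun n => hT.exists_yosida (hcpos n)
  have hsol : ∀ n, ∃ x, y - x - F n x ∈ A x := by
    intro n
    obtain ⟨x, v, hv, w, rfl, h⟩ := (hA.add_ofFun (hF n)).exists_smul_sub_mem one_pos y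
    refine ⟨x, ?_⟩
    simp only [inv_one, one_smul] at h
    rwa [← h, add_sub_cancel_right]
  choose x hx using hsol
  set u : ℕ → H := fun n => F n (x n) with hu
  have huT : ∀ n, u n ∈ T (x n - c n • u n) := fun n => hFT n (x n)
  have hf₀ : ∀ n, ‖F n x₀‖ ≤ ‖b₀‖ := by
    intro n
    have h1 := hT.1 _ _ _ _ (hFT n x₀) hb₀
    rw [sub_sub_cancel_left, inner_neg_left, real_inner_smul_left, inner_sub_right,
      real_inner_self_eq_norm_sq] at h1
    have h2 := real_inner_le_norm (F n x₀) b₀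
    have h3 : 0 ≤ c n * (⟪F n x₀, b₀⟫ - ‖F n x₀‖ ^ 2) := by linarith
    have h4 := nonneg_of_mul_nonneg_right h3 (hcpos n)
    nlinarith [norm_nonneg (F n x₀), norm_nonneg b₀]
  have hAx : ∀ n, ⟪x n - x₀, u n⟫ + ‖x n - x₀‖ ^ 2 ≤ ⟪x n - x₀, y - x₀ - v₀⟫ := by
    intro n
    have h1 := hA.1 _ _ _ _ (hx n) hv₀
    have h2 : y - x n - F n (x n) - v₀ = (y - x₀ - v₀) - u n - (x n - x₀) := by rw [hu]; abel
    rw [h2, inner_sub_right, inner_sub_right, real_inner_self_eq_norm_sq] at h1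
    linarith
  set R := ‖y - x₀ - v₀‖ + ‖b₀‖ with hRdef
  have hR : ∀ n, ‖x n - x₀‖ ≤ R := by
    intro n
    have h1 := (mul_nonneg (hcpos n).le (sq_nonneg _)).trans ((hF n).2 (x n) x₀)
    rw [inner_sub_right] at h1
    have h2 := hAx n
    have h3 := real_inner_le_norm (x n - x₀) (y - x₀ - v₀)
    have h4 := neg_le_of_abs_le (abs_real_inner_le_norm (x n - x₀) (F n x₀))
    have h5 := mul_le_mul_of_nonneg_left (hf₀ n) (norm_nonneg (x n - x₀))
    have h6 : ‖x n - x₀‖ * ‖x n - x₀‖ ≤ ‖x n - x₀‖ * R := by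
      rw [hRdef]
      nlinarith
    by_contra! hlt
    have hR0 : 0 ≤ R := by positivity
    exact absurd h6 (not_le.2 (mul_lt_mul_of_pos_left hlt (hR0.trans_lt hlt)))
  have hcu : ∀ n, ‖c n • u n‖ ≤ R + ‖b₀‖ := by
    intro n
    have h1 := (hF n).norm_sub_le (x n) x₀
    have h2 : ‖u n‖ ≤ ‖F n (x n) - F n x₀‖ + ‖F n x₀‖ := norm_le_norm_sub_add _ _
    rw [norm_smul, Real.norm_of_nonneg (hcpos n).le]
    have h3 := mul_le_mul_of_nonneg_left h2 (hcpos n).le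
    have h4 := mul_le_mul (hc1 n) (hf₀ n) (norm_nonneg _) zero_le_one
    linarith [hR n]
  -- The only use of interiority. Before `u n` is known to be bounded, `c n • u n` is, since `F n`
  -- is `1 / c n`-Lipschitz.
  obtain ⟨M, hM⟩ := hT.1.exists_bound_of_mem_interior hxT huT (R := R + (R + ‖b₀‖))
    (S := R * ‖y - x₀ - v₀‖)
    (fun n => by
      rw [sub_right_comm]
      exact (norm_sub_le _ _).trans (add_le_add (hR n) (hcu n)))
    (fun n => by
      rw [sub_right_comm, inner_sub_left, real_inner_smul_left, real_inner_self_eq_norm_sq]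
      have h1 := hAx n
      have h2 := real_inner_le_norm (x n - x₀) (y - x₀ - v₀)
      have h3 := mul_le_mul_of_nonneg_right (hR n) (norm_nonneg (y - x₀ - v₀))
      have h4 := mul_nonneg (hcpos n).le (sq_nonneg ‖u n‖)
      linarith [sq_nonneg ‖x n - x₀‖])
  have hM0 : 0 ≤ M := (norm_nonneg _).trans (hM 0)
  -- `T` is monotone at the shifted points `x n - c n • u n`, so `⟪x n - x k, u n - u k⟫` can be
  -- negative only by the size of the shifts.
  have hdist : ∀ n k, ‖x n - x k‖ ^ 2 ≤ 2 * M ^ 2 * (c n + c k) := by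
    intro n k
    have h1 := hA.1 _ _ _ _ (hx n) (hx k)
    have h2 : y - x n - F n (x n) - (y - x k - F k (x k)) = -(x n - x k) - (u n - u k) := by
      rw [hu]; abel
    rw [h2, inner_sub_right, inner_neg_right, real_inner_self_eq_norm_sq] at h1
    have h3 := hT.1 _ _ _ _ (huT n) (huT k)
    rw [sub_sub_sub_comm, inner_sub_left] at h3
    have h4 := neg_le_of_abs_le (abs_real_inner_le_norm (c n • u n - c k • u k) (u n - u k))
    have h5 : ‖c n • u n - c k • u k‖ ≤ (c n + c k) * M := by
      refine (norm_sub_le _ _).trans ?_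
      rw [norm_smul, norm_smul, Real.norm_of_nonneg (hcpos n).le,
        Real.norm_of_nonneg (hcpos k).le, add_mul]
      exact add_le_add (mul_le_mul_of_nonneg_left (hM n) (hcpos n).le)
        (mul_le_mul_of_nonneg_left (hM k) (hcpos k).le)
    have h6 : ‖u n - u k‖ ≤ M + M := (norm_sub_le _ _).trans (add_le_add (hM n) (hM k))
    have h7 := mul_le_mul h5 h6 (norm_nonneg _)
      (mul_nonneg (add_pos (hcpos n) (hcpos k)).le hM0)
    nlinarith
  have hcau : CauchySeq x := by
    refine cauchySeq_of_le_tendsto_0 (fun N => √(2 * M ^ 2 * (c N + c N)))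
      (fun n k N hn hk => ?_) ?_
    · rw [dist_eq_norm]
      refine Real.le_sqrt_of_sq_le ((hdist n k).trans ?_)
      simp only [hc]
      gcongr
    · have := ((hc0.add hc0).const_mul (2 * M ^ 2)).sqrt
      simpa using this
  obtain ⟨z, hz⟩ := cauchySeq_tendsto_of_complete hcau
  have hz' : Tendsto x (hyperfilter ℕ) (𝓝 z) := hz.mono_left Nat.hyperfilter_le_atTop
  obtain ⟨w, hw⟩ := exists_weak_limit (hyperfilter ℕ) hM
  have hcu0 : Tendsto (fun n => c n • u n) atTop (𝓝 0) := by
    refine squeeze_zero_norm (a := fun n => c n * M) (fun n => ?_) (by simpa using hc0.mul_const M)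
    rw [norm_smul, Real.norm_of_nonneg (hcpos n).le]
    exact mul_le_mul_of_nonneg_left (hM n) (hcpos n).le
  have hwT : w ∈ T z := by
    refine hT.mem_of_tendsto (l := (hyperfilter ℕ : Filter ℕ)) huT ?_ hM hw
    simpa using hz'.sub (hcu0.mono_left Nat.hyperfilter_le_atTop)
  have hwA : y - z - w ∈ A z := by
    refine hA.mem_of_tendsto (l := (hyperfilter ℕ : Filter ℕ)) hx hz'
      (M := ‖y - x₀‖ + R + M) (fun n => ?_) fun h => ?_
    · rw [← sub_sub_sub_cancel_right y (x n) x₀]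
      exact (norm_sub_le _ _).trans
        (add_le_add ((norm_sub_le _ _).trans (add_le_add_right (hR n) _)) (hM n))
    · simp only [inner_sub_left]
      exact (tendsto_const_nhds.sub (hz'.inner tendsto_const_nhds)).sub (hw h)
  refine ⟨z, _, ⟨_, hwA, _, hwT, rfl⟩, ?_⟩
  simp

theorem opDomain_add {E : Type*} [NormedAddCommGroup E] {S T : E → Set E} :
    opDomain (S + T) = opDomain S ∩ opDomain T := by
  ext x
  exact Set.add_nonempty

/-- The sum theorem asks for an interior point of one domain only, so the accumulated sum need only
contain `x₀` in its domain. -/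
theorem IsMaximallyMonotone.add_sum [CompleteSpace H] {ι : Type*} {T : H → Set H}
    (hT : IsMaximallyMonotone T) {A : ι → H → Set H} (hA : ∀ i, IsMaximallyMonotone (A i))
    {x₀ : H} (hxT : x₀ ∈ opDomain T) (hxA : ∀ i, x₀ ∈ interior (opDomain (A i))) (s : Finset ι) :
    IsMaximallyMonotone (T + ∑ i ∈ s, A i) ∧ x₀ ∈ opDomain (T + ∑ i ∈ s, A i) := by
  classical
  induction s using Finset.induction_on with
  | empty => simpa using ⟨hT, hxT⟩
  | insert i s his ih =>
    rw [Finset.sum_insert his, add_comm (A i), ← add_assoc]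
    refine ⟨ih.1.add (hA i) ih.2 (hxA i), ?_⟩
    rw [opDomain_add]
    exact ⟨ih.2, interior_subset (hxA i)⟩

/-! ### The normal cone of the zero set -/

/-- The projection of `y` onto `X` solves `y ∈ x + N_X x`, which is surjectivity. -/
theorem isMaximallyMonotone_normalCone [CompleteSpace H] {X : Set H} (hne : X.Nonempty)
    (hcl : IsClosed X) (hcv : Convex ℝ X) : IsMaximallyMonotone (normalCone X) := by
  refine isMaximallyMonotone_of_surjective ?_ one_pos fun y => ?_
  · rintro x u y v ⟨hx, hu⟩ ⟨hy, hv⟩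
    have h1 := hu y hy
    have h2 := hv x hx
    rw [← neg_sub x y, inner_neg_right] at h1
    rw [inner_sub_right, real_inner_comm, real_inner_comm v]
    linarith
  · obtain ⟨x, hx, hmin⟩ := exists_norm_eq_iInf_of_complete_convex hne hcl.isComplete hcv y
    exact ⟨x, y - x, ⟨hx, (norm_eq_iInf_iff_real_inner_le_zero hcv hx).1 hmin⟩, by simp⟩

theorem mem_zeros_ofFun {E : Type*} [NormedAddCommGroup E] {C : E → E} {z : E} :
    z ∈ zeros (ofFun C) ↔ C z = 0 := eq_comm

/-- Each condition on the right is affine in `z`, which exhibits the zero set as closed and convex;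
taking `x = z` gives the reverse inclusion. -/
theorem IsCocoercive.zeros_eq {C : H → H} {μ : ℝ} (hC : IsCocoercive μ C) :
    zeros (ofFun C) = {z | ∀ x, μ * ‖C x‖ ^ 2 ≤ ⟪x - z, C x⟫} := by
  ext z
  rw [mem_zeros_ofFun]
  refine ⟨fun hz x => by simpa [hz] using hC.2 x z, fun h => ?_⟩
  have h1 := h z
  rw [sub_self, inner_zero_left] at h1
  rw [← norm_eq_zero, ← sq_eq_zero_iff]
  exact le_antisymm (nonpos_of_mul_nonpos_right h1 hC.1) (sq_nonneg _)

theorem IsCocoercive.isMaximallyMonotone_normalCone_zeros [CompleteSpace H] {C : H → H} {μ : ℝ}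
    (hC : IsCocoercive μ C) (hne : (zeros (ofFun C)).Nonempty) :
    IsMaximallyMonotone (normalCone (zeros (ofFun C))) := by
  refine isMaximallyMonotone_normalCone hne ?_ ?_
  · rw [hC.zeros_eq, Set.ofPred_forall]
    exact isClosed_iInter fun x => isClosed_le continuous_const (by fun_prop)
  · rw [hC.zeros_eq]
    intro z hz w hw a b ha hb hab x
    have h1 := mul_le_mul_of_nonneg_left (hz x) ha
    have h2 := mul_le_mul_of_nonneg_left (hw x) hb
    have h3 : x - (a • z + b • w) = a • (x - z) + b • (x - w) := by
      rw [smul_sub, smul_sub, sub_add_sub_comm, ← add_smul, hab, one_smul]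
    rw [h3, inner_add_left, real_inner_smul_left, real_inner_smul_left]
    have h4 : μ * ‖C x‖ ^ 2 = a * (μ * ‖C x‖ ^ 2) + b * (μ * ‖C x‖ ^ 2) := by
      rw [← add_mul, hab, one_mul]
    linarith

/-- Under the qualification condition the operator of the inclusion problem is maximally
monotone. -/
theorem isMaximallyMonotone_inclusionOp [CompleteSpace H] {m : ℕ} {A : Fin m → H → Set H}
    (hA : ∀ i, IsMaximallyMonotone (A i)) {B C : H → H} {η μ : ℝ} (hB : IsCocoercive η B)
    (hC : IsCocoercive μ C)
    (hq : (zeros (ofFun C) ∩ ⋂ i, interior (opDomain (A i))).Nonempty) :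
    IsMaximallyMonotone (inclusionOp A B C) := by
  obtain ⟨x₀, hx₀, hxA⟩ := hq
  -- The normal cone is the base summand because `x₀` need not be interior to `zer C`.
  have h1 := (hC.isMaximallyMonotone_normalCone_zeros ⟨x₀, hx₀⟩).add_ofFun hB
  have h2 : x₀ ∈ opDomain (normalCone (zeros (ofFun C)) + ofFun B) := by
    rw [opDomain_add]
    exact ⟨⟨0, hx₀, fun z _ => by simp⟩, ⟨B x₀, rfl⟩⟩
  have h3 := (h1.add_sum hA h2 (fun i => Set.mem_iInter.1 hxA i) Finset.univ).1
  have h4 : inclusionOp A B C = normalCone (zeros (ofFun C)) + ofFun B + ∑ i, A i := by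
    rw [inclusionOp]; abel
  rwa [h4]

theorem mem_inclusionOp {m : ℕ} {A : Fin m → H → Set H} {B C : H → H} {u w : H} :
    w ∈ inclusionOp A B C u ↔ ∃ v : Fin m → H, (∀ i, v i ∈ A i u) ∧
      ∃ p ∈ normalCone (zeros (ofFun C)) u, ∑ i, v i + B u + p = w := by
  have hsum : ∀ s, s ∈ (∑ i, A i) u ↔ ∃ v : Fin m → H, (∀ i, v i ∈ A i u) ∧ ∑ i, v i = s := by
    intro s
    rw [Finset.sum_apply, Set.mem_fintype_sum]
    simp only [exists_prop]
  constructor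
  · rintro ⟨_, ⟨s, hs, _, rfl, rfl⟩, p, hp, rfl⟩
    obtain ⟨v, hv, rfl⟩ := (hsum s).1 hs
    exact ⟨v, hv, p, hp, rfl⟩
  · rintro ⟨v, hv, p, hp, rfl⟩
    exact ⟨_, ⟨_, (hsum _).2 ⟨v, hv, rfl⟩, B u, rfl, rfl⟩, p, hp, rfl⟩

/-! ### Quasi-Fejér sequences and weighted averages -/

/-- Telescoping: `∑ ε + ∑ c - a` is eventually nondecreasing. No sign is assumed on `c`, so this
serves both for the residuals and for the terms `2 α ⟪u - x, w⟫`. -/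
theorem sum_range_le_of_eventually_step {a ε c : ℕ → ℝ} (ha : ∀ k, 0 ≤ a k) (hε : Summable ε)
    (h : ∀ᶠ k in atTop, a (k + 1) ≤ a k + ε k + c k) :
    ∃ M, ∀ᶠ n in atTop, M ≤ ∑ k ∈ Finset.range n, c k := by
  obtain ⟨N, hN⟩ := eventually_atTop.1 h
  obtain ⟨E, hE⟩ := hε.hasSum.tendsto_sum_nat.bddAbove_range
  set f : ℕ → ℝ := fun n => ∑ k ∈ Finset.range n, ε k + ∑ k ∈ Finset.range n, c k - a n with hf
  have hmono : ∀ n ≥ N, f N ≤ f n := by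
    intro n hn
    induction n, hn using Nat.le_induction with
    | base => rfl
    | succ n hn ih =>
      have := hN n hn
      simp only [hf, Finset.sum_range_succ] at ih ⊢
      linarith
  refine ⟨f N - E, eventually_atTop.2 ⟨N, fun n hn => ?_⟩⟩
  have h1 := hmono n hn
  have h2 : ∑ k ∈ Finset.range n, ε k ≤ E := hE ⟨n, rfl⟩
  have h3 : f n = ∑ k ∈ Finset.range n, ε k + ∑ k ∈ Finset.range n, c k - a n := rfl
  linarith [ha n]

theorem summable_and_tendsto_of_eventually_step {a b ε : ℕ → ℝ} (ha : ∀ k, 0 ≤ a k)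
    (hb : ∀ k, 0 ≤ b k) (hε : Summable ε)
    (h : ∀ᶠ k in atTop, a (k + 1) ≤ a k - b k + ε k) :
    Summable b ∧ ∃ l, Tendsto a atTop (𝓝 l) := by
  obtain ⟨M, hM⟩ := sum_range_le_of_eventually_step (c := fun k => -b k) ha hε
    (h.mono fun k hk => by linarith)
  have hsum : Summable b := by
    refine summable_of_sum_range_le (c := -M) hb fun n => ?_
    obtain ⟨k, hk, hkn⟩ := (hM.and (eventually_ge_atTop n)).exists
    rw [Finset.sum_neg_distrib] at hk
    have := Finset.sum_le_sum_of_subset_of_nonneg (Finset.range_mono hkn) fun i _ _ => hb i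
    linarith
  refine ⟨hsum, ?_⟩
  obtain ⟨N, hN⟩ := eventually_atTop.1 h
  have hE := hε.hasSum.tendsto_sum_nat
  obtain ⟨E, hEb⟩ := hE.bddAbove_range
  -- Subtracting the accumulated errors leaves a decreasing sequence bounded below.
  set f : ℕ → ℝ := fun n => a (n + N) - ∑ k ∈ Finset.range (n + N), ε k with hf
  have hanti : Antitone f := antitone_nat_of_succ_le fun n => by
    have := hN (n + N) (Nat.le_add_left _ _)
    simp only [hf]
    rw [add_right_comm, Finset.sum_range_succ]
    linarith [hb (n + N)]
  have hlim := tendsto_atTop_ciInf hanti ⟨-E, by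
    rintro _ ⟨n, rfl⟩
    have h1 : ∑ k ∈ Finset.range (n + N), ε k ≤ E := hEb ⟨n + N, rfl⟩
    simp only [hf]
    linarith [ha (n + N)]⟩
  refine ⟨(⨅ n, f n) + ∑' k, ε k, (tendsto_add_atTop_iff_nat N).1 ?_⟩
  have := hlim.add (hE.comp (tendsto_add_atTop_nat N))
  refine this.congr fun n => ?_
  simp [hf]

/-- Weighted Cesàro convergence. -/
theorem tendsto_weighted_average {α s : ℕ → ℝ} (hα : ∀ k, 0 < α k) (hsum : ¬ Summable α) {l : ℝ}
    (hs : Tendsto s atTop (𝓝 l)) :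
    Tendsto (fun n => (∑ k ∈ Finset.range (n + 1), α k)⁻¹ *
      ∑ k ∈ Finset.range (n + 1), α k * s k) atTop (𝓝 l) := by
  have htop := (not_summable_iff_tendsto_nat_atTop_of_nonneg fun k => (hα k).le).1 hsum
  have h1 : (fun k => α k * (s k - l)) =o[atTop] α := by
    have h2 : (fun k => s k - l) =o[atTop] fun _ => (1 : ℝ) := by
      rw [Asymptotics.isLittleO_one_iff]
      simpa using hs.sub_const l
    simpa using (Asymptotics.isBigO_refl α atTop).mul_isLittleO h2
  have h3 := (h1.sum_range (fun k => (hα k).le) htop).tendsto_div_nhds_zero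
  have h4 := (h3.comp (tendsto_add_atTop_nat 1)).add_const l
  rw [zero_add] at h4
  refine h4.congr fun n => ?_
  have hpos : 0 < ∑ k ∈ Finset.range (n + 1), α k :=
    Finset.sum_pos (fun k _ => hα k) Finset.nonempty_range_add_one
  simp only [Function.comp, mul_sub, Finset.sum_sub_distrib, ← Finset.sum_mul]
  field_simp
  ring

theorem inner_ergodicAverage (α : ℕ → ℝ) (x : ℕ → H) (h : H) (n : ℕ) :
    ⟪ergodicAverage α x n, h⟫ = (∑ k ∈ Finset.range (n + 1), α k)⁻¹ *
      ∑ k ∈ Finset.range (n + 1), α k * ⟪x k, h⟫ := by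
  rw [ergodicAverage, real_inner_smul_left, sum_inner]
  simp only [real_inner_smul_left]

theorem norm_ergodicAverage_le {α : ℕ → ℝ} (hα : ∀ k, 0 < α k) {x : ℕ → H} {M : ℝ}
    (hM : ∀ k, ‖x k‖ ≤ M) (n : ℕ) : ‖ergodicAverage α x n‖ ≤ M := by
  have hpos : 0 < ∑ k ∈ Finset.range (n + 1), α k :=
    Finset.sum_pos (fun k _ => hα k) Finset.nonempty_range_add_one
  rw [ergodicAverage, norm_smul, norm_inv, Real.norm_of_nonneg hpos.le, inv_mul_le_iff₀ hpos,
    Finset.sum_mul]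
  refine (norm_sum_le _ _).trans (Finset.sum_le_sum fun k _ => ?_)
  rw [norm_smul, Real.norm_of_nonneg (hα k).le]
  exact mul_le_mul_of_nonneg_left (hM k) (hα k).le

/-- The Opial-Passty lemma for ergodic averages. -/
theorem exists_weak_limit_ergodicAverage [CompleteSpace H] {α : ℕ → ℝ} (hα : ∀ k, 0 < α k)
    (hsum : ¬ Summable α) {x : ℕ → H} {Z : Set H} (hne : Z.Nonempty)
    (hlim : ∀ u ∈ Z, ∃ l : ℝ, Tendsto (fun k => ‖x k - u‖) atTop (𝓝 l))
    (hclus : ∀ (l : Ultrafilter ℕ) (w : H), ↑l ≤ (atTop : Filter ℕ) →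
      (∀ h, Tendsto (fun n => ⟪ergodicAverage α x n, h⟫) l (𝓝 ⟪w, h⟫)) → w ∈ Z) :
    ∃ z ∈ Z, ∀ h, Tendsto (fun n => ⟪ergodicAverage α x n, h⟫) atTop (𝓝 ⟪z, h⟫) := by
  obtain ⟨u₀, hu₀⟩ := hne
  obtain ⟨l₀, hl₀⟩ := hlim u₀ hu₀
  obtain ⟨M, hM⟩ := hl₀.bddAbove_range
  have hxb : ∀ k, ‖x k‖ ≤ M + ‖u₀‖ := fun k =>
    (norm_le_norm_sub_add _ u₀).trans (add_le_add_left (hM ⟨k, rfl⟩) _)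
  have hzb := norm_ergodicAverage_le hα hxb
  -- `‖x - v‖² - ‖x - u‖²` is affine in `x` with linear part `2⟪x, u - v⟫`, so these products
  -- converge, and so do their averages. With `u, v` two cluster points, this forces them to be
  -- equal.
  have hdiff : ∀ u ∈ Z, ∀ v ∈ Z, ∃ t : ℝ,
      Tendsto (fun n => ⟪ergodicAverage α x n, u - v⟫) atTop (𝓝 t) := by
    intro u hu v hv
    obtain ⟨a, ha⟩ := hlim u hu
    obtain ⟨b, hb⟩ := hlim v hv
    have h1 : Tendsto (fun k => ⟪x k, u - v⟫) atTop
        (𝓝 ((b ^ 2 - a ^ 2 + (‖u‖ ^ 2 - ‖v‖ ^ 2)) / 2)) := by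
      refine ((((hb.pow 2).sub (ha.pow 2)).add_const _).div_const 2).congr fun k => ?_
      rw [norm_sub_sq_real, norm_sub_sq_real, inner_sub_right]
      ring
    exact ⟨_, (tendsto_weighted_average hα hsum h1).congr fun n =>
      (inner_ergodicAverage α x _ n).symm⟩
  have huniq : ∀ (l l' : Ultrafilter ℕ) (w w' : H), ↑l ≤ (atTop : Filter ℕ) →
      ↑l' ≤ (atTop : Filter ℕ) →
      (∀ h, Tendsto (fun n => ⟪ergodicAverage α x n, h⟫) l (𝓝 ⟪w, h⟫)) →
      (∀ h, Tendsto (fun n => ⟪ergodicAverage α x n, h⟫) l' (𝓝 ⟪w', h⟫)) → w = w' := by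
    intro l l' w w' hl hl' hw hw'
    obtain ⟨t, ht⟩ := hdiff w (hclus l w hl hw) w' (hclus l' w' hl' hw')
    have h1 := tendsto_nhds_unique (hw (w - w')) (ht.mono_left hl)
    have h2 := tendsto_nhds_unique (hw' (w - w')) (ht.mono_left hl')
    rw [← sub_eq_zero, ← inner_self_eq_zero (𝕜 := ℝ), inner_sub_left, h1, h2, sub_self]
  obtain ⟨z, hz⟩ := exists_weak_limit (hyperfilter ℕ) hzb
  refine ⟨z, hclus _ z Nat.hyperfilter_le_atTop hz, fun h => ?_⟩
  rw [tendsto_iff_ultrafilter]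
  intro l hl
  obtain ⟨w, hw⟩ := exists_weak_limit l hzb
  rw [huniq _ _ z w Nat.hyperfilter_le_atTop hl hz hw]
  exact hw h

theorem tendsto_toWeakSpace [CompleteSpace H] {ι : Type*} {l : Filter ι} {f : ι → H} {z : H}
    (h : ∀ y, Tendsto (fun i => ⟪f i, y⟫) l (𝓝 ⟪z, y⟫)) :
    Tendsto (fun i => toWeakSpace ℝ H (f i)) l (𝓝 (toWeakSpace ℝ H z)) := by
  refine (WeakBilin.tendsto_iff_forall_eval_tendsto (topDualPairing ℝ H).flip ?_).2 fun φ => ?_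
  · intro a b hab
    refine ext_inner_left ℝ fun v => ?_
    exact LinearMap.congr_fun hab (innerSL ℝ v)
  · have h1 : ∀ y, ⟪y, (InnerProductSpace.toDual ℝ H).symm φ⟫ = φ y := fun y => by
      rw [real_inner_comm, InnerProductSpace.toDual_symm_apply]
    have h2 := h ((InnerProductSpace.toDual ℝ H).symm φ)
    simp only [h1] at h2
    exact h2

/-! ### Estimates for the iteration -/

/-- The summability condition bounds the penalty terms along any sequence of points. -/
theorem FitzpatrickSummable.exists_bound {C : H → H} {α β : ℕ → ℝ}
    (h : FitzpatrickSummable C α β) (hα : ∀ k, 0 < α k) (hβ : ∀ k, 0 < β k) {u p : H}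
    (hp : p ∈ normalCone (zeros (ofFun C)) u) :
    ∃ g : ℕ → ℝ, Summable g ∧
      ∀ k x, α k * ⟪x - u, p⟫ - α k * β k * ⟪x - u, C x⟫ ≤ g k := by
  have hsum := h p ⟨u, hp⟩
  refine ⟨_, ENNReal.summable_toReal hsum.ne, fun k x => ?_⟩
  have hfin := ENNReal.ne_top_of_tsum_ne_top hsum.ne k
  -- Bound the gap below by testing the Fitzpatrick function of `u` at `(x, C x)`; the support
  -- function is at most its value at `u` since `p` is normal there. The bound is uniform in `x`.
  have hσ : supportFun (zeros (ofFun C)) ((β k)⁻¹ • p) ≤ ((⟪(β k)⁻¹ • p, u⟫ : ℝ) : EReal) := by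
    refine iSup₂_le fun z hz => EReal.coe_le_coe_iff.2 ?_
    have h1 := hp.2 z hz
    rw [inner_sub_right] at h1
    rw [real_inner_smul_left, real_inner_smul_left]
    exact mul_le_mul_of_nonneg_left (by linarith) (inv_pos.2 (hβ k)).le
  have hφ : ((⟪u, C x⟫ + ⟪x, (β k)⁻¹ • p⟫ - ⟪x, C x⟫ : ℝ) : EReal) ≤
      ⨆ u ∈ zeros (ofFun C), fitzpatrick (ofFun C) u ((β k)⁻¹ • p) := by
    refine le_trans ?_ (le_iSup₂ (f := fun u _ => fitzpatrick (ofFun C) u ((β k)⁻¹ • p)) u hp.1)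
    exact le_iSup₂ (f := fun (q : H × H) (_ : q ∈ opGraph (ofFun C)) =>
      ((⟪u, q.2⟫ + ⟪q.1, (β k)⁻¹ • p⟫ - ⟪q.1, q.2⟫ : ℝ) : EReal)) (x, C x) rfl
  have hgap := EReal.sub_le_sub hφ hσ
  rw [← EReal.coe_sub] at hgap
  have hpos : 0 < α k * β k := mul_pos (hα k) (hβ k)
  have h1 := mul_le_mul_of_nonneg_left hgap (EReal.coe_nonneg.2 hpos.le)
  rw [← EReal.coe_mul] at h1
  have h2 := ENNReal.toReal_mono hfin (EReal.toENNReal_le_toENNReal h1)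
  rw [EReal.toENNReal_of_ne_top (EReal.coe_ne_top _), EReal.toReal_coe] at h2
  rw [ENNReal.toReal_ofReal'] at h2
  refine le_trans (le_of_eq ?_) ((le_max_left _ _).trans h2)
  simp only [inner_sub_left, real_inner_smul_left, real_inner_smul_right]
  rw [real_inner_comm u p]
  have := (hβ k).ne'
  field_simp
  ring

/-- Triangle inequality along the first `j` steps; the remaining steps are added to make the bound
independent of `j`. -/
theorem norm_sub_le_sum {E : Type*} [NormedAddCommGroup E] {m : ℕ} (y : Fin (m + 1) → E) (j : Fin (m + 1)) :
    ‖y 0 - y j‖ ≤ ∑ i : Fin m, ‖y i.succ - y i.castSucc‖ := by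
  have key : ‖y 0 - y j‖ ≤
      ∑ i : Fin m, if i.castSucc < j then ‖y i.succ - y i.castSucc‖ else 0 := by
    induction j using Fin.induction with
    | zero => simp
    | succ j ih =>
      have h1 : ‖y 0 - y j.succ‖ ≤ ‖y 0 - y j.castSucc‖ + ‖y j.succ - y j.castSucc‖ := by
        rw [norm_sub_rev (y j.succ)]
        exact norm_sub_le_norm_sub_add_norm_sub _ _ _
      have h2 : ‖y j.succ - y j.castSucc‖ =
          ∑ i : Fin m, if i = j then ‖y i.succ - y i.castSucc‖ else 0 := by simp
      refine h1.trans ((add_le_add ih h2.le).trans ?_)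
      rw [← Finset.sum_add_distrib]
      refine Finset.sum_le_sum fun i _ => ?_
      rcases lt_trichotomy i j with hij | rfl | hij
      · simp [hij, hij.ne, hij.le]
      · simp
      · simp [hij.not_gt, hij.ne', hij.not_ge]
  refine key.trans (Finset.sum_le_sum fun i _ => ?_)
  split_ifs
  · rfl
  · exact norm_nonneg _

/-- Effect of the backward steps. -/
theorem backward_estimate {m : ℕ} (hm : 1 ≤ m) {A : Fin m → H → Set H}
    (hA : ∀ i, IsMonotoneOp (A i)) {a : ℝ} (ha : 0 < a) {y : Fin (m + 1) → H}
    (hy : ∀ i : Fin m, y i.succ ∈ opResolvent (a • A i) (y i.castSucc)) {u : H} {v : Fin m → H}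
    (hv : ∀ i, v i ∈ A i u) :
    ‖y (Fin.last m) - u‖ ^ 2 ≤ ‖y 0 - u‖ ^ 2
      - (∑ i : Fin m, ‖y i.succ - y i.castSucc‖ ^ 2) / 2
      + 2 * m * a ^ 2 * (∑ i, ‖v i‖) ^ 2 + 2 * a * ⟪∑ i, v i, u - y 0⟫ := by
  have hstep : ∀ i : Fin m, ‖y i.succ - u‖ ^ 2 ≤ ‖y i.castSucc - u‖ ^ 2
      - ‖y i.succ - y i.castSucc‖ ^ 2 + 2 * a * ⟪v i, u - y i.succ⟫ := by
    intro i
    obtain ⟨_, rfl, _, ⟨e, he, rfl⟩, heq⟩ := hy i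
    have h1 := mul_nonneg ha.le (hA i _ _ _ _ he (hv i))
    have h2 : y i.castSucc - u = (y i.succ - u) + a • e := by
      rw [← heq]
      change y i.succ + a • e - u = _
      abel
    have h3 : y i.succ - y i.castSucc = -(a • e) := by
      rw [← heq]
      change y i.succ - (y i.succ + a • e) = _
      abel
    rw [h2, h3, norm_neg, norm_add_sq_real, real_inner_smul_right, ← neg_sub (y i.succ) u,
      inner_neg_right, real_inner_comm _ (v i)]
    rw [inner_sub_right] at h1
    linarith
  have hsum := Finset.sum_le_sum fun i (_ : i ∈ Finset.univ) => hstep i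
  rw [Finset.sum_add_distrib, Finset.sum_sub_distrib, ← Finset.mul_sum] at hsum
  have htel := (Fin.sum_univ_succ fun j => ‖y j - u‖ ^ 2).symm.trans
    (Fin.sum_univ_castSucc fun j => ‖y j - u‖ ^ 2)
  set R := ∑ i : Fin m, ‖y i.succ - y i.castSucc‖ with hR
  set S := ∑ i : Fin m, ‖y i.succ - y i.castSucc‖ ^ 2 with hS
  set W := ∑ i, ‖v i‖ with hW
  have hRS : R ^ 2 ≤ m * S := by
    simpa using sq_sum_le_card_mul_sum_sq (s := Finset.univ)
      (f := fun i : Fin m => ‖y i.succ - y i.castSucc‖)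
  -- Move every inner product to the common base point `y 0`, at cost `W * R`.
  have hin : ∑ i, ⟪v i, u - y i.succ⟫ ≤ ⟪∑ i, v i, u - y 0⟫ + W * R := by
    rw [sum_inner, hW, Finset.sum_mul, ← Finset.sum_add_distrib]
    refine Finset.sum_le_sum fun i _ => ?_
    rw [← sub_add_sub_cancel u (y 0), inner_add_right]
    gcongr
    exact (real_inner_le_norm _ _).trans
      (mul_le_mul_of_nonneg_left (norm_sub_le_sum y _) (norm_nonneg _))
  have hm' : (0 : ℝ) < m := by exact_mod_cast hm
  -- Young's inequality and `R² ≤ m S`: half of the step residual `S` absorbs the cost.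
  have hWR : 2 * a * (W * R) ≤ 2 * m * a ^ 2 * W ^ 2 + S / 2 := by
    refine le_of_mul_le_mul_left ?_ (mul_pos two_pos hm')
    nlinarith [sq_nonneg (2 * m * a * W - R)]
  have h5 := mul_le_mul_of_nonneg_left hin (mul_pos two_pos ha).le
  linarith

/-- Effect of the forward step. -/
theorem forward_estimate {r b b₀ c V : H} {a γ η μ : ℝ} (ha : 0 < a) (hγ : 0 < γ) (hγμ : γ ≤ μ)
    (haη : 45 / 4 * a ≤ η) (hb : η * ‖b - b₀‖ ^ 2 ≤ ⟪r, b - b₀⟫) (hc : μ * ‖c‖ ^ 2 ≤ ⟪r, c⟫) :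
    ‖r - (a • b + γ • c)‖ ^ 2 + 2 * a * ⟪V, a • b + γ • c⟫ ≤
      ‖r‖ ^ 2 - 3 / 4 * (γ * ⟪r, c⟫) - 2 * a * ⟪r, b₀⟫
        + a ^ 2 * (8 * ‖V‖ ^ 2 + 45 / 2 * ‖b₀‖ ^ 2) := by
  -- Choice of constants: `h2` leaves `9/8` of `‖a b + γ c‖²`, and `h3` turns this into `45/4 ·
  -- a²‖b‖² + 5/4 · γ²‖c‖²`. As `5/4 < 2`, the bound `γ ≤ μ` leaves `-(3/4) γ ⟪r, c⟫`. The `b` part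
  -- is absorbed once `a` is small against `η`.
  have h1 : ‖r - (a • b + γ • c)‖ ^ 2 =
      ‖r‖ ^ 2 - 2 * (a * ⟪r, b⟫ + γ * ⟪r, c⟫) + ‖a • b + γ • c‖ ^ 2 := by
    rw [norm_sub_sq_real, inner_add_right, real_inner_smul_right, real_inner_smul_right]
  have h2 : 2 * a * ⟪V, a • b + γ • c⟫ ≤ 8 * (a ^ 2 * ‖V‖ ^ 2) + ‖a • b + γ • c‖ ^ 2 / 8 := by
    have := sq_nonneg ‖(8 * a) • V - (a • b + γ • c)‖
    rw [norm_sub_sq_real, real_inner_smul_left, norm_smul, mul_pow, Real.norm_eq_abs, sq_abs]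
      at this
    linarith
  have h3 : ‖a • b + γ • c‖ ^ 2 ≤ 10 * (a ^ 2 * ‖b‖ ^ 2) + 10 / 9 * (γ ^ 2 * ‖c‖ ^ 2) := by
    have := sq_nonneg ‖(9 : ℝ) • (a • b) - γ • c‖
    rw [norm_sub_sq_real, real_inner_smul_left, norm_smul (9 : ℝ), mul_pow (‖(9 : ℝ)‖)] at this
    have e1 : ‖a • b‖ ^ 2 = a ^ 2 * ‖b‖ ^ 2 := by
      rw [norm_smul, mul_pow, Real.norm_eq_abs, sq_abs]
    have e2 : ‖γ • c‖ ^ 2 = γ ^ 2 * ‖c‖ ^ 2 := by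
      rw [norm_smul, mul_pow, Real.norm_eq_abs, sq_abs]
    rw [e1, e2] at this
    rw [norm_add_sq_real, e1, e2]
    norm_num at this
    linarith
  have h4 : ‖b‖ ^ 2 ≤ 2 * ‖b - b₀‖ ^ 2 + 2 * ‖b₀‖ ^ 2 := by
    have := parallelogram_law_with_norm ℝ (b - b₀) b₀
    rw [sub_add_cancel] at this
    nlinarith [mul_self_nonneg ‖b - b₀ - b₀‖]
  have h5 : γ ^ 2 * ‖c‖ ^ 2 ≤ γ * ⟪r, c⟫ := by
    have := mul_le_mul_of_nonneg_left
      ((mul_le_mul_of_nonneg_right hγμ (sq_nonneg ‖c‖)).trans hc) hγ.le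
    linarith
  have h6 : 45 / 4 * (a ^ 2 * ‖b - b₀‖ ^ 2) ≤ a * (⟪r, b⟫ - ⟪r, b₀⟫) := by
    rw [← inner_sub_right]
    have := mul_le_mul_of_nonneg_left
      ((mul_le_mul_of_nonneg_right haη (sq_nonneg ‖b - b₀‖)).trans hb) ha.le
    linarith
  have h7 := mul_le_mul_of_nonneg_left h4 (sq_nonneg a)
  linarith

/-- The fundamental inequality: `x` is quasi-Fejér up to a term depending on `w`. -/
theorem IsGFBP.exists_step_le {m : ℕ} (hm : 1 ≤ m) {A : Fin m → H → Set H}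
    (hA : ∀ i, IsMonotoneOp (A i)) {B C : H → H} {η μ : ℝ} (hB : IsCocoercive η B)
    (hC : IsCocoercive μ C) {α β : ℕ → ℝ} (hα : ∀ k, 0 < α k) (hβ : ∀ k, 0 < β k)
    {x : ℕ → H} {ψ : ℕ → Fin (m + 1) → H} (hx : IsGFBP A B C α β x ψ)
    (hF : FitzpatrickSummable C α β) (hαβ : ∀ᶠ k in atTop, α k * β k ≤ μ)
    (hα2 : Summable fun k => α k ^ 2) {u w : H} (hw : w ∈ inclusionOp A B C u) :
    ∃ ε : ℕ → ℝ, Summable ε ∧ ∀ᶠ k in atTop, ‖x (k + 1) - u‖ ^ 2 ≤ ‖x k - u‖ ^ 2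
      - ((∑ i : Fin m, ‖ψ k i.succ - ψ k i.castSucc‖ ^ 2) / 2
        + α k * β k * ⟪x k - u, C (x k)⟫ / 4)
      + ε k + 2 * (α k * ⟪u - x k, w⟫) := by
  obtain ⟨v, hv, p, hp, rfl⟩ := mem_inclusionOp.1 hw
  -- With `4 p` in place of `p`, the normal term `2 α ⟪x - u, p⟫` uses up only `1/2` of the
  -- available `3/4` of the penalty term, leaving `1/4`.
  have hp4 : (4 : ℝ) • p ∈ normalCone (zeros (ofFun C)) u := ⟨hp.1, fun z hz => by
    rw [real_inner_smul_left]
    linarith [hp.2 z hz]⟩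
  obtain ⟨g, hg, hgk⟩ := hF.exists_bound hα hβ hp4
  refine ⟨fun k => α k ^ 2 * (2 * m * (∑ i, ‖v i‖) ^ 2 + 8 * ‖∑ i, v i‖ ^ 2
    + 45 / 2 * ‖B u‖ ^ 2) + g k / 2, (hα2.mul_right _).add (hg.div_const 2), ?_⟩
  have hsmall : ∀ᶠ k in atTop, 45 / 4 * α k ≤ η := by
    have h1 : Tendsto α atTop (𝓝 0) := by
      have := hα2.tendsto_atTop_zero.sqrt
      simpa [Real.sqrt_sq (hα _).le] using this
    have h2 := h1.const_mul (45 / 4)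
    rw [mul_zero] at h2
    exact (h2.eventually (gt_mem_nhds hB.1)).mono fun k hk => le_of_lt hk
  filter_upwards [hαβ, hsmall] with k hk1 hk2
  have hCu : C u = 0 := mem_zeros_ofFun.1 hp.1
  have h1 := backward_estimate hm hA (hα k) (hx.backward_step k) hv
  have h2 := forward_estimate (V := ∑ i, v i) (hα k) (mul_pos (hα k) (hβ k)) hk1 hk2
    (hB.2 (x k) u) (by simpa [hCu] using hC.2 (x k) u)
  have h3 := hgk k (x k)
  have e1 : ψ k 0 - u = x k - u - (α k • B (x k) + (α k * β k) • C (x k)) := by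
    rw [hx.forward_step]; abel
  have e2 : u - ψ k 0 = -(x k - u) + (α k • B (x k) + (α k * β k) • C (x k)) := by
    rw [← neg_sub, e1, neg_sub, neg_add_eq_sub]
  rw [← hx.next_iterate, e1, e2, inner_add_right, inner_neg_right, real_inner_comm] at h1
  rw [real_inner_smul_right] at h3
  rw [← neg_sub (x k) u, inner_neg_left, inner_add_right, inner_add_right]
  linarith

theorem IsCocoercive.le_inner_of_mem_zeros {C : H → H} {μ : ℝ} (hC : IsCocoercive μ C) {u : H}
    (hu : u ∈ zeros (ofFun C)) (x : H) : μ * ‖C x‖ ^ 2 ≤ ⟪x - u, C x⟫ := by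
  rw [hC.zeros_eq] at hu
  exact hu x

theorem mem_zeros_of_mem_inclusionOp {m : ℕ} {A : Fin m → H → Set H} {B C : H → H} {u w : H}
    (hw : w ∈ inclusionOp A B C u) : u ∈ zeros (ofFun C) := by
  obtain ⟨-, -, p, hp, -⟩ := mem_inclusionOp.1 hw
  exact hp.1

/-- Convergence of the distances and summability of the error terms. -/
theorem IsGFBP.tendsto_and_summable {m : ℕ} (hm : 1 ≤ m) {A : Fin m → H → Set H}
    (hA : ∀ i, IsMonotoneOp (A i)) {B C : H → H} {η μ : ℝ} (hB : IsCocoercive η B)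
    (hC : IsCocoercive μ C) {α β : ℕ → ℝ} (hα : ∀ k, 0 < α k) (hβ : ∀ k, 0 < β k)
    {x : ℕ → H} {ψ : ℕ → Fin (m + 1) → H} (hx : IsGFBP A B C α β x ψ)
    (hF : FitzpatrickSummable C α β) (hαβ : ∀ᶠ k in atTop, α k * β k ≤ μ)
    (hα2 : Summable fun k => α k ^ 2) {u : H} (hu : u ∈ zeros (inclusionOp A B C)) :
    (∃ l : ℝ, Tendsto (fun k => ‖x k - u‖) atTop (𝓝 l)) ∧
      Summable (fun k => ∑ i : Fin m, ‖ψ k i.succ - ψ k i.castSucc‖ ^ 2) ∧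
      Summable (fun k => α k * β k * ‖C (x k)‖ ^ 2) ∧
      Summable (fun k => α k * β k * ⟪x k - u, C (x k)⟫) := by
  have hCx := hC.le_inner_of_mem_zeros (mem_zeros_of_mem_inclusionOp hu)
  have hpos : ∀ k, 0 < α k * β k := fun k => mul_pos (hα k) (hβ k)
  have hC0 : ∀ k, 0 ≤ α k * β k * ⟪x k - u, C (x k)⟫ := fun k =>
    mul_nonneg (hpos k).le ((mul_nonneg hC.1.le (sq_nonneg _)).trans (hCx _))
  have hS0 : ∀ k, 0 ≤ ∑ i : Fin m, ‖ψ k i.succ - ψ k i.castSucc‖ ^ 2 := fun k =>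
    Finset.sum_nonneg fun i _ => sq_nonneg _
  obtain ⟨ε, hε, hstep⟩ := hx.exists_step_le hm hA hB hC hα hβ hF hαβ hα2 hu
  obtain ⟨hsum, l, hl⟩ := summable_and_tendsto_of_eventually_step
    (a := fun k => ‖x k - u‖ ^ 2) (fun k => sq_nonneg _)
    (fun k => add_nonneg (div_nonneg (hS0 k) two_pos.le) (div_nonneg (hC0 k) four_pos.le)) hε
    (hstep.mono fun k hk => by simpa using hk)
  have hCsum : Summable fun k => α k * β k * ⟪x k - u, C (x k)⟫ :=
    (hsum.mul_left 4).of_nonneg_of_le hC0 fun k => by linarith [hS0 k]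
  refine ⟨⟨√l, ?_⟩, (hsum.mul_left 2).of_nonneg_of_le hS0 fun k => by linarith [hC0 k], ?_, hCsum⟩
  · simpa only [Real.sqrt_sq (norm_nonneg _)] using hl.sqrt
  · refine (hCsum.div_const μ).of_nonneg_of_le
      (fun k => mul_nonneg (hpos k).le (sq_nonneg _)) fun k => ?_
    rw [le_div_iff₀ hC.1]
    have := mul_le_mul_of_nonneg_left (hCx (x k)) (hpos k).le
    linarith

/-- Weak cluster points of the ergodic averages solve the inclusion problem. -/
theorem IsGFBP.mem_zeros_of_weak_cluster {m : ℕ} (hm : 1 ≤ m) {A : Fin m → H → Set H}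
    (hA : ∀ i, IsMonotoneOp (A i)) {B C : H → H} {η μ : ℝ} (hB : IsCocoercive η B)
    (hC : IsCocoercive μ C) {α β : ℕ → ℝ} (hα : ∀ k, 0 < α k) (hβ : ∀ k, 0 < β k)
    {x : ℕ → H} {ψ : ℕ → Fin (m + 1) → H} (hx : IsGFBP A B C α β x ψ)
    (hF : FitzpatrickSummable C α β) (hαβ : ∀ᶠ k in atTop, α k * β k ≤ μ)
    (hα2 : Summable fun k => α k ^ 2) (hα1 : ¬ Summable α)
    (hmax : IsMaximallyMonotone (inclusionOp A B C)) {l : Filter ℕ} [l.NeBot] (hl : l ≤ atTop)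
    {z : H} (hz : ∀ h, Tendsto (fun n => ⟪ergodicAverage α x n, h⟫) l (𝓝 ⟪z, h⟫)) :
    z ∈ zeros (inclusionOp A B C) := by
  refine hmax.mem_of_forall fun u w hw => ?_
  have hCx := hC.le_inner_of_mem_zeros (mem_zeros_of_mem_inclusionOp hw)
  obtain ⟨ε, hε, hstep⟩ := hx.exists_step_le hm hA hB hC hα hβ hF hαβ hα2 hw
  -- Drop the residuals: the partial sums of `2 α ⟪u - x, w⟫` are bounded below, so dividing by `∑ α
  -- → ∞` makes the bound vanish in the limit.
  obtain ⟨M, hM⟩ := sum_range_le_of_eventually_step (a := fun k => ‖x k - u‖ ^ 2)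
    (c := fun k => 2 * (α k * ⟪u - x k, w⟫)) (fun k => sq_nonneg _) hε
    (hstep.mono fun k hk => by
      have h1 : 0 ≤ ∑ i : Fin m, ‖ψ k i.succ - ψ k i.castSucc‖ ^ 2 :=
        Finset.sum_nonneg fun i _ => sq_nonneg _
      have h2 := mul_nonneg (mul_pos (hα k) (hβ k)).le
        ((mul_nonneg hC.1.le (sq_nonneg _)).trans (hCx (x k)))
      linarith)
  have htop := (tendsto_add_atTop_iff_nat 1).2
    ((not_summable_iff_tendsto_nat_atTop_of_nonneg fun k => (hα k).le).1 hα1)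
  have hlow : Tendsto (fun n => (∑ k ∈ Finset.range (n + 1), α k)⁻¹ * M / 2) l (𝓝 0) := by
    simpa using ((htop.inv_tendsto_atTop.mul_const M).div_const 2).mono_left hl
  have hlim := (tendsto_const_nhds (x := ⟪u, w⟫)).sub (hz w)
  have h0 : 0 ≤ ⟪u, w⟫ - ⟪z, w⟫ := by
    refine le_of_tendsto_of_tendsto hlow hlim (hl ?_)
    filter_upwards [(tendsto_add_atTop_nat 1).eventually hM] with n hn
    have hpos : 0 < ∑ k ∈ Finset.range (n + 1), α k :=
      Finset.sum_pos (fun k _ => hα k) Finset.nonempty_range_add_one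
    simp only [← Finset.mul_sum, inner_sub_left, mul_sub, Finset.sum_sub_distrib,
      ← Finset.sum_mul] at hn
    rw [inner_ergodicAverage]
    have h1 := mul_le_mul_of_nonneg_left hn (inv_pos.2 hpos).le
    have h2 : (∑ k ∈ Finset.range (n + 1), α k)⁻¹ * (∑ k ∈ Finset.range (n + 1), α k) = 1 :=
      inv_mul_cancel₀ hpos.ne'
    calc _ ≤ _ := div_le_div_of_nonneg_right h1 two_pos.le
      _ = (∑ k ∈ Finset.range (n + 1), α k)⁻¹ * (∑ k ∈ Finset.range (n + 1), α k) * ⟪u, w⟫ -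
          (∑ k ∈ Finset.range (n + 1), α k)⁻¹ *
            ∑ k ∈ Finset.range (n + 1), α k * ⟪x k, w⟫ := by ring
      _ = _ := by rw [h2, one_mul]
  rwa [zero_sub, inner_neg_right, inner_sub_left, neg_sub]

end PenaltySplitting

theorem theorem3p1 {H : Type*} [NormedAddCommGroup H] [InnerProductSpace ℝ H] [CompleteSpace H]
    (m : ℕ) (hm : 1 ≤ m)
    (A : Fin m → H → Set H) (hA : ∀ i, IsMaximallyMonotone (A i))
    (B C : H → H) (η μ : ℝ) (hB : IsCocoercive η B) (hC : IsCocoercive μ C)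
    -- the inclusion problem is solvable
    (hzer : (zeros (inclusionOp A B C)).Nonempty)
    (α β : ℕ → ℝ) (hα : ∀ k, 0 < α k) (hβ : ∀ k, 0 < β k)
    (x : ℕ → H) (ψ : ℕ → Fin (m + 1) → H) (hx : IsGFBP A B C α β x ψ)
    -- qualification condition
    (H1 : (zeros (ofFun C) ∩ ⋂ i, interior (opDomain (A i))).Nonempty)
    (H2 : FitzpatrickSummable C α β)
    -- liminf and limsup are taken in the extended reals
    (H3 : 0 < liminf (fun k => ((α k * β k : ℝ) : EReal)) atTop ∧
      limsup (fun k => ((α k * β k : ℝ) : EReal)) atTop < (μ : EReal))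
    (H4 : Summable (fun k => α k ^ 2) ∧ ¬ Summable α) :
    (∀ u ∈ zeros (inclusionOp A B C),
      (∃ l : ℝ, Tendsto (fun k => ‖x k - u‖) atTop (𝓝 l)) ∧
      Summable (fun k => ∑ i : Fin m, ‖ψ k i.succ - ψ k i.castSucc‖ ^ 2) ∧
      Summable (fun k => α k * β k * ‖C (x k)‖ ^ 2) ∧
      Summable (fun k => α k * β k * ⟪x k - u, C (x k)⟫)) ∧
    (∀ u ∈ zeros (inclusionOp A B C),
      Tendsto (fun k => ∑ i : Fin m, ‖ψ k i.succ - ψ k i.castSucc‖ ^ 2) atTop (𝓝 0) ∧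
      Tendsto (fun k => ⟪x k - u, C (x k)⟫) atTop (𝓝 0) ∧
      Tendsto (fun k => ‖C (x k)‖) atTop (𝓝 0)) ∧
    (∃ z ∈ zeros (inclusionOp A B C),
      Tendsto (fun k => toWeakSpace ℝ H (ergodicAverage α x k)) atTop
        (𝓝 (toWeakSpace ℝ H z))) := by
  have hmax := isMaximallyMonotone_inclusionOp hA hB hC H1
  have hlt : ∀ᶠ k in atTop, α k * β k ≤ μ :=
    (eventually_lt_of_limsup_lt H3.2).mono fun k hk => (EReal.coe_lt_coe_iff.1 hk).le
  -- The positive lower bound on `α β` is needed only for (ii), to pass from the weighted terms to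
  -- the unweighted ones.
  obtain ⟨c, hc0, hc⟩ := EReal.lt_iff_exists_real_btwn.1 H3.1
  have hc0' : 0 < c := EReal.coe_pos.1 hc0
  have hgt : ∀ᶠ k in atTop, c ≤ α k * β k :=
    (eventually_lt_of_lt_liminf hc).mono fun k hk => (EReal.coe_lt_coe_iff.1 hk).le
  have hfejer := fun u (hu : u ∈ zeros (inclusionOp A B C)) =>
    hx.tendsto_and_summable hm (fun i => (hA i).1) hB hC hα hβ H2 hlt H4.1 hu
  refine ⟨hfejer, fun u hu => ?_, ?_⟩
  · obtain ⟨-, h1, -, h2⟩ := hfejer u hu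
    have hCx := hC.le_inner_of_mem_zeros (mem_zeros_of_mem_inclusionOp hu)
    have hnn : ∀ k, 0 ≤ ⟪x k - u, C (x k)⟫ := fun k =>
      (mul_nonneg hC.1.le (sq_nonneg _)).trans (hCx _)
    have h3 : Tendsto (fun k => ⟪x k - u, C (x k)⟫) atTop (𝓝 0) := by
      have h4 := h2.tendsto_atTop_zero.div_const c
      rw [zero_div] at h4
      refine squeeze_zero' (Eventually.of_forall hnn) (hgt.mono fun k hk => ?_) h4
      rw [le_div_iff₀ hc0', mul_comm]
      exact mul_le_mul_of_nonneg_right hk (hnn k)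
    refine ⟨h1.tendsto_atTop_zero, h3, ?_⟩
    have h5 : Tendsto (fun k => ‖C (x k)‖ ^ 2) atTop (𝓝 0) := by
      refine squeeze_zero (fun k => sq_nonneg _) (fun k => ?_) (by simpa using h3.div_const μ)
      rw [le_div_iff₀ hC.1, mul_comm]
      exact hCx (x k)
    simpa [Real.sqrt_sq (norm_nonneg _)] using h5.sqrt
  · obtain ⟨z, hz, hlim⟩ := exists_weak_limit_ergodicAverage hα H4.2 hzer
      (fun u hu => (hfejer u hu).1) fun l w hl hw =>
        hx.mem_zeros_of_weak_cluster hm (fun i => (hA i).1) hB hC hα hβ H2 hlt H4.1 H4.2 hmax hl hw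
    exact ⟨z, hz, tendsto_toWeakSpace hlim⟩
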